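/- All graphs are finite and simple. The degree sequence of a graph is the list of its vertex degrees in non-increasing order, and a realization of a degree sequence $d$ is a graph whose degree sequence is $d$. A graph is self-complementary if it is isomorphic to its complement, and a degree sequence is forcibly self-complementary if every realization of it is self-complementary. Call a graph a block if it is isomorphic to the path $P_4$ on four vertices or to one of the two graphs on $\{a_0,a_1,a_2,a_3,b_0,b_1,b_2,b_3\}$ in which $\{a_0,\dots,a_3\}$ is a clique, $\{b_0,\dots,b_3\}$ is an independent set, and the edges between these two sets form either a single cycle of length $8$ or two disjoint cycles of length $4$. The vertex set of each block has a unique partition into a clique and an independent set. An elementary self-complementary pseudo-split graph is a graph isomorphic to one obtained as follows. Take $p \ge 0$ vertex-disjoint blocks $S_1,\dots,S_p$, where $S_i$ has clique $K_i$ and independent set $I_i$, and a further disjoint graph $C$ that is empty, a single vertex, or a five-cycle; for all $1\le i<j\le p$ add all edges between $K_i$ and $K_j\cup I_j$; and add all edges between $C$ and $\bigcup_{i=1}^p K_i$. **Theorem.** A degree sequence is forcibly self-complementary if and only if every realization of it is an elementary self-complementary pseudo-split graph. -/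

import Mathlib

universe u

namespace ForciblySC

/-- A graph is self-complementary if it is isomorphic to its complement. -/
def IsSelfComplementary {V : Type u} (G : SimpleGraph V) : Prop :=
  Nonempty (G ≃g Gᶜ)

/-- The degree sequence of a finite graph: its vertex degrees in non-increasing order. -/
def degreeSequence {V : Type u} [Fintype V] (G : SimpleGraph V) [DecidableRel G.Adj] : List ℕ :=
  ((Finset.univ : Finset V).val.map (fun v => G.degree v)).sort (fun a b => a ≥ b)

/-- `d` is the degree sequence of some finite graph. -/
def IsDegreeSequence (d : List ℕ) : Prop :=
  ∃ (V : Type u) (_ : Fintype V) (G : SimpleGraph V) (_ : DecidableRel G.Adj),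
    degreeSequence G = d

/-- `d` is forcibly self-complementary: all its realizations are self-complementary. -/
def IsForciblySelfComplementary (d : List ℕ) : Prop :=
  ∀ (V : Type u) [Fintype V] (G : SimpleGraph V) [DecidableRel G.Adj],
    degreeSequence G = d → IsSelfComplementary G

/-- The split graph in which `A` is a clique, `B` is an independent set, and `a ∈ A`, `b ∈ B` are
adjacent iff `r a b`. -/
def splitGraph {A B : Type} (r : A → B → Prop) : SimpleGraph (A ⊕ B) where
  Adj x y :=
    match x, y with
    | .inl a, .inl a' => a ≠ a'
    | .inl a, .inr b => r a b
    | .inr b, .inl a => r a b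
    | .inr _, .inr _ => False
  symm := ⟨by
    rintro (a | b) (a' | b') h
    · exact Ne.symm h
    · exact h
    · exact h
    · exact h⟩
  loopless := ⟨by
    rintro (a | b) h
    · exact h rfl
    · exact h⟩

/-- The 8-vertex self-complementary split graph whose edges between the clique and the independent
set form an 8-cycle (addition in `Fin 4` is modulo 4). -/
def eightCycleSplit : SimpleGraph (Fin 4 ⊕ Fin 4) :=
  splitGraph fun a b : Fin 4 => b = a ∨ b = a + 1

/-- The 8-vertex self-complementary split graph whose edges between the clique and the independent
set form two disjoint 4-cycles. -/
def twoFourCyclesSplit : SimpleGraph (Fin 4 ⊕ Fin 4) :=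
  splitGraph fun a b : Fin 4 => a.val / 2 = b.val / 2

/-- The admissible blocks. -/
def IsBlock {W : Type u} (S : SimpleGraph W) : Prop :=
  Nonempty (S ≃g SimpleGraph.pathGraph 4) ∨
    Nonempty (S ≃g eightCycleSplit) ∨ Nonempty (S ≃g twoFourCyclesSplit)

/-- `K` and its complement form a split partition of `S`: a clique and an independent set.
(For an admissible block there is exactly one such `K`.) -/
def IsSplitPartition {W : Type u} (S : SimpleGraph W) (K : Set W) : Prop :=
  S.IsClique K ∧ S.IsIndepSet Kᶜ

/-- The admissible central parts: no vertex, a single vertex, or a five-cycle. -/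
def IsCore {X : Type u} (C : SimpleGraph X) : Prop :=
  IsEmpty X ∨ Nonempty (Unique X) ∨ Nonempty (C ≃g SimpleGraph.cycleGraph 5)

/-- Adjacency in the graph obtained from the disjoint union of the `S i` and `C` by making, for
all `i < j`, the set `K i` complete to the whole of `S j`, and `C` complete to every `K i`. -/
inductive CompositionAdj {p : ℕ} {W : Fin p → Type u} (S : ∀ i, SimpleGraph (W i))
    (K : ∀ i, Set (W i)) {X : Type u} (C : SimpleGraph X) :
    (Σ i, W i) ⊕ X → (Σ i, W i) ⊕ X → Prop
  | block (i : Fin p) (u v : W i) (h : (S i).Adj u v) :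
      CompositionAdj S K C (.inl ⟨i, u⟩) (.inl ⟨i, v⟩)
  | lt (i j : Fin p) (u : W i) (v : W j) (hij : i < j) (hu : u ∈ K i) :
      CompositionAdj S K C (.inl ⟨i, u⟩) (.inl ⟨j, v⟩)
  | gt (i j : Fin p) (u : W i) (v : W j) (hij : i < j) (hu : u ∈ K i) :
      CompositionAdj S K C (.inl ⟨j, v⟩) (.inl ⟨i, u⟩)
  | toCore (i : Fin p) (u : W i) (x : X) (hu : u ∈ K i) :
      CompositionAdj S K C (.inl ⟨i, u⟩) (.inr x)
  | ofCore (i : Fin p) (u : W i) (x : X) (hu : u ∈ K i) :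
      CompositionAdj S K C (.inr x) (.inl ⟨i, u⟩)
  | core (x y : X) (h : C.Adj x y) :
      CompositionAdj S K C (.inr x) (.inr y)

/-- The graph with adjacency `CompositionAdj`. -/
def composition {p : ℕ} {W : Fin p → Type u} (S : ∀ i, SimpleGraph (W i))
    (K : ∀ i, Set (W i)) {X : Type u} (C : SimpleGraph X) :
    SimpleGraph ((Σ i, W i) ⊕ X) where
  Adj := CompositionAdj S K C
  symm := ⟨by
    intro x y h
    cases h with
    | block i u v h => exact .block i v u h.symm
    | lt i j u v hij hu => exact .gt i j u v hij hu
    | gt i j u v hij hu => exact .lt i j u v hij hu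
    | toCore i u x hu => exact .ofCore i u x hu
    | ofCore i u x hu => exact .toCore i u x hu
    | core x y h => exact .core y x h.symm⟩
  loopless := ⟨by
    intro x h
    cases h with
    | block i u v h => exact (S i).irrefl h
    | lt i j u v hij hu => exact lt_irrefl _ hij
    | gt i j u v hij hu => exact lt_irrefl _ hij
    | core x y h => exact C.irrefl h⟩

/-- Elementary self-complementary pseudo-split graphs: up to isomorphism, the compositions of
`p ≥ 0` admissible blocks, each with its split partition `K i`, and an admissible central part. -/
def IsElementarySCPseudoSplit {V : Type u} (G : SimpleGraph V) : Prop :=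
  ∃ (p : ℕ) (W : Fin p → Type u) (S : ∀ i, SimpleGraph (W i)) (K : ∀ i, Set (W i))
    (X : Type u) (C : SimpleGraph X),
    (∀ i, IsBlock (S i) ∧ IsSplitPartition (S i) (K i)) ∧ IsCore C ∧
      Nonempty (G ≃g composition S K C)

end ForciblySC

/-
An isomorphism `G ≃g Gᶜ` exchanges the set `A` of vertices of maximum degree with the set `B` of
vertices of minimum degree, so exactly half of the pairs in `A × B` are edges, in every
realization. Hence no degree-preserving switch may change the number of edges between `A` and `B`.
If the graph is not regular, this forces the neighbours of `B` to lie in `A`, and dually every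
vertex of `A` is joined to everything outside `B`. Then `A ∪ B` induces a split graph, whose
realizations are again self-complementary; rearranging its edges between `A` and `B` shows that
it is a block. The graph induced outside `A ∪ B` inherits the hypothesis, and induction applies.
A regular graph of degree `2 * m` on `4 * m + 1` vertices is a core if `m ≤ 1`; otherwise
`apexBipartite` has the same degrees without being self-complementary.

Conversely, every block has an isomorphism with its complement exchanging its clique and its
independent set. Together with one for the core these form an isomorphism of the composition with
its complement.
-/

namespace ForciblySC

open Finset
open scoped Classical

/-! ### Self-complementary graphs -/

/-- The isomorphism of complements induced by an isomorphism of graphs. -/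
def complIso {V W : Type*} {G : SimpleGraph V} {H : SimpleGraph W} (e : G ≃g H) : Gᶜ ≃g Hᶜ where
  toEquiv := e.toEquiv
  map_rel_iff' {a b} := by
    simp only [SimpleGraph.compl_adj, RelIso.coe_fn_toEquiv, e.map_adj_iff, ne_eq,
      EmbeddingLike.apply_eq_iff_eq]

theorem IsSelfComplementary.of_iso {V W : Type*} {G : SimpleGraph V} {H : SimpleGraph W}
    (e : G ≃g H) (h : IsSelfComplementary H) : IsSelfComplementary G :=
  h.map fun σ => (e.trans σ).trans (complIso e.symm)

theorem antimorphism_adj {V : Type*} {G : SimpleGraph V} (σ : G ≃g Gᶜ) {x y : V} (h : x ≠ y) :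
    G.Adj (σ x) (σ y) ↔ ¬ G.Adj x y := by
  have := σ.map_adj_iff (v := x) (w := y)
  have hσ : σ x ≠ σ y := σ.injective.ne h
  grind [SimpleGraph.compl_adj]

theorem cycleGraph_five_isSelfComplementary :
    IsSelfComplementary (SimpleGraph.cycleGraph 5) :=
  ⟨⟨⟨fun x => 2 * x, fun x => 3 * x, by decide, by decide⟩, by decide⟩⟩

theorem IsCore.isSelfComplementary {X : Type u} {C : SimpleGraph X} (h : IsCore C) :
    IsSelfComplementary C := by
  rcases h with _ | ⟨⟨_⟩⟩ | ⟨⟨e⟩⟩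
  · exact ⟨⟨Equiv.refl X, fun {a} => isEmptyElim a⟩⟩
  · exact ⟨⟨Equiv.refl X, fun {a b} => by simp [Subsingleton.elim a b]⟩⟩
  · exact cycleGraph_five_isSelfComplementary.of_iso e

/-! ### Split graphs and blocks -/

theorem IsBlock.of_iso {V W : Type*} {G : SimpleGraph V} {H : SimpleGraph W} (e : G ≃g H) :
    IsBlock H → IsBlock G :=
  Or.imp (Nonempty.map e.trans) (Or.imp (Nonempty.map e.trans) (Nonempty.map e.trans))

theorem IsSplitPartition.preimage {V W : Type*} {G : SimpleGraph V} {H : SimpleGraph W}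
    (e : G ≃g H) {K : Set W} (hK : IsSplitPartition H K) : IsSplitPartition G (e ⁻¹' K) :=
  ⟨fun _ hx _ hy hxy => e.map_adj_iff.1 (hK.1 hx hy (e.injective.ne hxy)),
    fun _ hx _ hy hxy h => hK.2 hx hy (e.injective.ne hxy) (e.map_adj_iff.2 h)⟩

/-- `S` has an antimorphism that interchanges `K` with its complement. -/
def HasSwap {W : Type u} (S : SimpleGraph W) (K : Set W) : Prop :=
  ∃ σ : S ≃g Sᶜ, ∀ v, σ v ∈ K ↔ v ∉ K

theorem HasSwap.preimage {V W : Type*} {G : SimpleGraph V} {H : SimpleGraph W} (e : G ≃g H)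
    {K : Set W} (h : HasSwap H K) : HasSwap G (e ⁻¹' K) := by
  obtain ⟨σ, hσ⟩ := h
  refine ⟨(e.trans σ).trans (complIso e.symm), fun v => ?_⟩
  have : e (((e.trans σ).trans (complIso e.symm)) v) = σ (e v) := e.apply_symm_apply _
  simp only [Set.mem_preimage, this, hσ]

section SplitGraph

variable {A B A' B' : Type}

/-- The isomorphism of split graphs that relabels the clique by `e` and the independent set
by `f`. -/
def splitGraphCongr {r : A → B → Prop} {r' : A' → B' → Prop} (e : A ≃ A') (f : B ≃ B')
    (h : ∀ a b, r' (e a) (f b) ↔ r a b) : splitGraph r ≃g splitGraph r' where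
  toEquiv := e.sumCongr f
  map_rel_iff' := by
    rintro (a | b) (a' | b') <;> simp [splitGraph, h]

/-- The isomorphism from a split graph onto its complement that sends the clique to the
independent set by `e` and the independent set to the clique by `f`. -/
def splitGraphAntimorphism {r : A → B → Prop} (e : A ≃ B) (f : B ≃ A)
    (h : ∀ a b, r (f b) (e a) ↔ ¬ r a b) : splitGraph r ≃g (splitGraph r)ᶜ where
  toEquiv := (e.sumCongr f).trans (Equiv.sumComm B A)
  map_rel_iff' := by
    rintro (a | b) (a' | b') <;> simp [splitGraph, SimpleGraph.compl_adj, h]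

theorem eq_isLeft_of_isSplitPartition_splitGraph {r : A → B → Prop}
    (h₁ : ∀ b, ∃ a b', b' ≠ b ∧ ¬ r a b ∧ r a b') (h₂ : ∀ a, ∃ b, r a b)
    {K : Set (A ⊕ B)} (hK : IsSplitPartition (splitGraph r) K) : K = {x | x.isLeft} := by
  have hb (b : B) : Sum.inr b ∉ K := by
    intro hbK
    obtain ⟨a, b', hne, hna, hab⟩ := h₁ b
    have ha : Sum.inl a ∉ K := fun ha => hna (hK.1 ha hbK (by simp))
    have hb' : Sum.inr b' ∉ K := fun hb' => hK.1 hb' hbK (by simpa using hne)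
    exact hK.2 ha hb' (by simp) hab
  have ha (a : A) : Sum.inl a ∈ K := by
    by_contra ha
    obtain ⟨b, hab⟩ := h₂ a
    exact hK.2 ha (hb b) (by simp) hab
  ext (a | b)
  · simpa using ha a
  · simpa using hb b

theorem hasSwap_of_iso_splitGraph {W : Type*} {S : SimpleGraph W} {r : A → B → Prop}
    (g : S ≃g splitGraph r)
    (h₁ : ∀ b, ∃ a b', b' ≠ b ∧ ¬ r a b ∧ r a b') (h₂ : ∀ a, ∃ b, r a b)
    (e : A ≃ B) (f : B ≃ A) (h : ∀ a b, r (f b) (e a) ↔ ¬ r a b)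
    {K : Set W} (hK : IsSplitPartition S K) : HasSwap S K := by
  have hswap : HasSwap (splitGraph r) {x | x.isLeft} :=
    ⟨splitGraphAntimorphism e f h, by rintro (a | b) <;> simp [splitGraphAntimorphism]⟩
  have hK' : g.symm ⁻¹' K = {x | x.isLeft} :=
    eq_isLeft_of_isSplitPartition_splitGraph h₁ h₂ (hK.preimage g.symm)
  convert hswap.preimage g
  rw [← hK', ← Set.preimage_comp]
  simp [Function.comp_def]

/-- The path on four vertices as a split graph, the two inner vertices forming the clique. -/
def pathGraphFourIso :
    SimpleGraph.pathGraph 4 ≃g splitGraph (fun a b : Fin 2 => a = b) where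
  toFun := ![.inr 0, .inl 0, .inl 1, .inr 1]
  invFun := Sum.elim ![1, 2] ![0, 3]
  left_inv := by decide
  right_inv := by decide
  map_rel_iff' {a b} := by
    rw [SimpleGraph.pathGraph_adj]
    fin_cases a <;> fin_cases b <;> simp [splitGraph]

theorem IsBlock.hasSwap {W : Type*} {S : SimpleGraph W} (hS : IsBlock S) {K : Set W}
    (hK : IsSplitPartition S K) : HasSwap S K := by
  rcases hS with ⟨⟨g⟩⟩ | ⟨⟨g⟩⟩ | ⟨⟨g⟩⟩
  · exact hasSwap_of_iso_splitGraph (g.trans pathGraphFourIso) (by decide) (by decide)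
      (Equiv.refl _) (Equiv.addRight 1) (by decide) hK
  · exact hasSwap_of_iso_splitGraph g (by decide) (by decide)
      (Equiv.refl _) (Equiv.addRight 1) (by decide) hK
  · exact hasSwap_of_iso_splitGraph g (by decide) (by decide)
      (Equiv.refl _) (Equiv.addRight 2) (by decide) hK

end SplitGraph

/-! ### Compositions -/

/-- Tyshkevich's composition of `S`, with distinguished vertex set `K`, and `H`: the disjoint union
of `S` and `H` together with all edges between `K` and `H`. Iterating it gives `composition`. -/
def splitComposition {W U : Type*} (S : SimpleGraph W) (K : Set W) (H : SimpleGraph U) :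
    SimpleGraph (W ⊕ U) where
  Adj
    | .inl u, .inl v => S.Adj u v
    | .inl u, .inr _ => u ∈ K
    | .inr _, .inl v => v ∈ K
    | .inr x, .inr y => H.Adj x y
  symm := ⟨by
    rintro (u | x) (v | y) h
    exacts [h.symm, h, h, h.symm]⟩
  loopless := ⟨by
    rintro (u | x) h
    exacts [S.irrefl h, H.irrefl h]⟩

/-- Composition respects isomorphism in its second argument. -/
def splitCompositionCongr {W U U' : Type*} (S : SimpleGraph W) (K : Set W) {H : SimpleGraph U}
    {H' : SimpleGraph U'} (e : H ≃g H') : splitComposition S K H ≃g splitComposition S K H' where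
  toEquiv := (Equiv.refl W).sumCongr e.toEquiv
  map_rel_iff' := by
    rintro (u | x) (v | y)
    exacts [Iff.rfl, Iff.rfl, Iff.rfl, e.map_adj_iff]

theorem HasSwap.splitComposition_isSelfComplementary {W U : Type*} {S : SimpleGraph W} {K : Set W}
    {H : SimpleGraph U} (hS : HasSwap S K) (hH : IsSelfComplementary H) :
    IsSelfComplementary (splitComposition S K H) := by
  obtain ⟨σ, hσ⟩ := hS
  obtain ⟨τ⟩ := hH
  refine ⟨σ.toEquiv.sumCongr τ.toEquiv, ?_⟩
  rintro (u | x) (v | y)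
  · simpa [splitComposition, SimpleGraph.compl_adj] using σ.map_adj_iff (v := u) (w := v)
  · simp [splitComposition, SimpleGraph.compl_adj, hσ]
  · simp [splitComposition, SimpleGraph.compl_adj, hσ]
  · simpa [splitComposition, SimpleGraph.compl_adj] using τ.map_adj_iff (v := x) (w := y)

/-- A graph is the composition of two induced subgraphs when its edges between them are those at
a set `K`. -/
noncomputable def isoSplitComposition {V : Type*} (G : SimpleGraph V) (T K : Set V)
    (h : ∀ v ∈ T, ∀ w ∉ T, (G.Adj v w ↔ v ∈ K)) :
    G ≃g splitComposition (G.induce T) {v | ↑v ∈ K} (G.induce Tᶜ) :=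
  RelIso.symm
    { toEquiv := Equiv.Set.sumCompl T
      map_rel_iff' := by
        rintro (⟨v, hv⟩ | ⟨v, hv⟩) (⟨w, hw⟩ | ⟨w, hw⟩)
        · simp [splitComposition]
        · simpa [splitComposition] using h v hv w hw
        · simpa [splitComposition, G.adj_comm v w] using h w hw v hv
        · simp [splitComposition] }

section Composition

variable {p : ℕ} {W : Fin p → Type u} (S : ∀ i, SimpleGraph (W i))
  (K : ∀ i, Set (W i)) {X : Type u} (C : SimpleGraph X)

theorem composition_adj_inl_inl_same (i : Fin p) (u v : W i) :
    (composition S K C).Adj (.inl ⟨i, u⟩) (.inl ⟨i, v⟩) ↔ (S i).Adj u v := by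
  constructor
  · rintro (⟨_, _, _, h⟩ | ⟨_, _, _, _, h, _⟩ | ⟨_, _, _, _, h, _⟩)
    exacts [h, absurd h (lt_irrefl _), absurd h (lt_irrefl _)]
  · exact .block i u v

theorem composition_adj_inl_inl_of_lt {i j : Fin p} (hij : i < j) (u : W i) (v : W j) :
    (composition S K C).Adj (.inl ⟨i, u⟩) (.inl ⟨j, v⟩) ↔ u ∈ K i := by
  constructor
  · rintro (⟨_, _, _, h⟩ | ⟨_, _, _, _, h, h'⟩ | ⟨_, _, _, _, h, _⟩)
    exacts [absurd hij (lt_irrefl _), h', absurd h hij.not_gt]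
  · exact .lt i j u v hij

theorem composition_adj_inl_inl_of_gt {i j : Fin p} (hij : j < i) (u : W i) (v : W j) :
    (composition S K C).Adj (.inl ⟨i, u⟩) (.inl ⟨j, v⟩) ↔ v ∈ K j := by
  rw [SimpleGraph.adj_comm, composition_adj_inl_inl_of_lt S K C hij]

theorem composition_adj_inl_inr (i : Fin p) (u : W i) (x : X) :
    (composition S K C).Adj (.inl ⟨i, u⟩) (.inr x) ↔ u ∈ K i := by
  constructor
  · rintro (_ | _ | _ | ⟨_, _, _, h⟩)
    exact h
  · exact .toCore i u x

theorem composition_adj_inr_inl (x : X) (i : Fin p) (u : W i) :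
    (composition S K C).Adj (.inr x) (.inl ⟨i, u⟩) ↔ u ∈ K i := by
  rw [SimpleGraph.adj_comm, composition_adj_inl_inr]

theorem composition_adj_inr_inr (x y : X) :
    (composition S K C).Adj (.inr x) (.inr y) ↔ C.Adj x y := by
  constructor
  · rintro (_ | _ | _ | _ | _ | ⟨_, _, h⟩)
    exact h
  · exact .core x y

end Composition

/-- A composition without blocks is its core. -/
def compositionZeroIso {W : Fin 0 → Type u} (S : ∀ i, SimpleGraph (W i)) (K : ∀ i, Set (W i))
    {X : Type u} (C : SimpleGraph X) : composition S K C ≃g C where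
  toEquiv := Equiv.emptySum _ _
  map_rel_iff' := by
    rintro (⟨i, -⟩ | x) (⟨j, -⟩ | y)
    exacts [i.elim0, i.elim0, j.elim0, (composition_adj_inr_inr S K C x y).symm]

section CompositionSucc

variable {p : ℕ} {W : Fin (p + 1) → Type u} (S : ∀ i, SimpleGraph (W i))
  (K : ∀ i, Set (W i)) {X : Type u} (C : SimpleGraph X)

theorem composition_adj_succ (x y : (Σ i : Fin p, W i.succ) ⊕ X) :
    (composition S K C).Adj (x.map (Sigma.map Fin.succ fun _ => id) id)
        (y.map (Sigma.map Fin.succ fun _ => id) id) ↔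
      (composition (fun i => S i.succ) (fun i => K i.succ) C).Adj x y := by
  let S' := fun i : Fin p => S i.succ
  let K' := fun i : Fin p => K i.succ
  rcases x with ⟨i, u⟩ | x <;> rcases y with ⟨j, v⟩ | y
  · rcases lt_trichotomy i j with h | rfl | h
    · exact (composition_adj_inl_inl_of_lt S K C (Fin.succ_lt_succ_iff.2 h) u v).trans
        (composition_adj_inl_inl_of_lt S' K' C h u v).symm
    · exact (composition_adj_inl_inl_same S K C _ u v).trans
        (composition_adj_inl_inl_same S' K' C i u v).symm
    · exact (composition_adj_inl_inl_of_gt S K C (Fin.succ_lt_succ_iff.2 h) u v).trans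
        (composition_adj_inl_inl_of_gt S' K' C h u v).symm
  · exact (composition_adj_inl_inr S K C _ u y).trans (composition_adj_inl_inr S' K' C i u y).symm
  · exact (composition_adj_inr_inl S K C x _ v).trans (composition_adj_inr_inl S' K' C x j v).symm
  · exact (composition_adj_inr_inr S K C x y).trans (composition_adj_inr_inr S' K' C x y).symm

theorem composition_adj_zero_succ (u : W 0) (x : (Σ i : Fin p, W i.succ) ⊕ X) :
    (composition S K C).Adj (.inl ⟨0, u⟩) (x.map (Sigma.map Fin.succ fun _ => id) id) ↔
      u ∈ K 0 := by
  rcases x with ⟨i, v⟩ | x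
  · exact composition_adj_inl_inl_of_lt S K C i.succ_pos u v
  · exact composition_adj_inl_inr S K C 0 u x

/-- A composition of blocks is the composition of the first block with that of the others. -/
def compositionSuccIso :
    composition S K C ≃g splitComposition (S 0) (K 0)
      (composition (fun i => S i.succ) (fun i => K i.succ) C) :=
  RelIso.symm
    { toFun := Sum.elim (fun u => .inl ⟨0, u⟩) (Sum.map (Sigma.map Fin.succ fun _ => id) id)
      invFun := Sum.elim
        (fun x => Fin.cases (motive := fun i => W i → W 0 ⊕ ((Σ i : Fin p, W i.succ) ⊕ X))
          .inl (fun i u => .inr (.inl ⟨i, u⟩)) x.1 x.2)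
        (fun x => .inr (.inr x))
      left_inv := by rintro (u | ⟨i, u⟩ | x) <;> rfl
      right_inv := by
        rintro (⟨i, u⟩ | x)
        · cases i using Fin.cases <;> rfl
        · rfl
      map_rel_iff' := by
        rintro (u | x) (v | y)
        · exact composition_adj_inl_inl_same S K C 0 u v
        · exact composition_adj_zero_succ S K C u y
        · exact (SimpleGraph.adj_comm ..).trans (composition_adj_zero_succ S K C v x)
        · exact composition_adj_succ S K C x y }

end CompositionSucc

theorem composition_isSelfComplementary {p : ℕ} {W : Fin p → Type u} (S : ∀ i, SimpleGraph (W i))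
    (K : ∀ i, Set (W i)) {X : Type u} (C : SimpleGraph X) (hS : ∀ i, HasSwap (S i) (K i))
    (hC : IsSelfComplementary C) : IsSelfComplementary (composition S K C) := by
  induction p with
  | zero => exact hC.of_iso (compositionZeroIso S K C)
  | succ p ih =>
    exact ((hS 0).splitComposition_isSelfComplementary (ih _ _ fun i => hS i.succ)).of_iso
      (compositionSuccIso S K C)

theorem IsElementarySCPseudoSplit.isSelfComplementary {V : Type*} {G : SimpleGraph V}
    (h : IsElementarySCPseudoSplit G) : IsSelfComplementary G := by
  obtain ⟨p, W, S, K, X, C, hS, hC, ⟨e⟩⟩ := h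
  exact (composition_isSelfComplementary S K C (fun i => (hS i).1.hasSwap (hS i).2)
    hC.isSelfComplementary).of_iso e

theorem IsElementarySCPseudoSplit.of_iso {V W : Type u} {G : SimpleGraph V} {H : SimpleGraph W}
    (e : G ≃g H) (h : IsElementarySCPseudoSplit H) : IsElementarySCPseudoSplit G := by
  obtain ⟨p, W, S, K, X, C, hS, hC, ⟨f⟩⟩ := h
  exact ⟨p, W, S, K, X, C, hS, hC, ⟨e.trans f⟩⟩

theorem IsCore.isElementarySCPseudoSplit {X : Type*} {C : SimpleGraph X} (h : IsCore C) :
    IsElementarySCPseudoSplit C :=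
  ⟨0, fun _ => X, fun _ => C, fun _ => ∅, X, C, fun i => i.elim0, h,
    ⟨(compositionZeroIso _ _ C).symm⟩⟩

theorem IsBlock.splitComposition {W U : Type u} {S : SimpleGraph W} {K : Set W} {H : SimpleGraph U}
    (hS : IsBlock S) (hK : IsSplitPartition S K) (hH : IsElementarySCPseudoSplit H) :
    IsElementarySCPseudoSplit (splitComposition S K H) := by
  obtain ⟨p, W', S', K', X, C, hS', hC, ⟨e⟩⟩ := hH
  let W'' : Fin (p + 1) → Type u := Fin.cons W W'
  let S'' (i : Fin (p + 1)) : SimpleGraph (W'' i) := i.cases S S'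
  let K'' (i : Fin (p + 1)) : Set (W'' i) := i.cases K K'
  refine ⟨p + 1, W'', S'', K'', X, C, fun i => i.cases ⟨hS, hK⟩ hS', hC, ⟨?_⟩⟩
  exact (splitCompositionCongr S K e).trans (compositionSuccIso S'' K'' C).symm

/-! ### Degrees -/

theorem degree_eq_card_filter {V : Type*} [Fintype V] (G : SimpleGraph V) (v : V) :
    G.degree v = #{w | G.Adj v w} := by
  rw [← G.card_neighborFinset_eq_degree, G.neighborFinset_eq_filter]

/-- `H` and `G` have the same degree at every vertex: they are realizations of the same degree
sequence that agree on which vertex has which degree. -/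
def SameDegrees {V : Type*} [Fintype V] (H G : SimpleGraph V) : Prop :=
  ∀ v, H.degree v = G.degree v

/-- Every realization of the degrees of `G` on the vertex set of `G` is self-complementary. -/
def ForcesSC {V : Type*} [Fintype V] (G : SimpleGraph V) : Prop :=
  ∀ H : SimpleGraph V, SameDegrees H G → IsSelfComplementary H

theorem IsForciblySelfComplementary.forcesSC {d : List ℕ}
    (hd : IsForciblySelfComplementary.{u} d) {V : Type u} [Fintype V] {G : SimpleGraph V}
    [DecidableRel G.Adj] (hG : degreeSequence G = d) : ForcesSC G := by
  refine fun H hH => hd V H (Eq.trans ?_ hG)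
  unfold degreeSequence
  congr 2
  funext v
  convert hH v

section Degree

variable {V : Type*} [Fintype V] {G H : SimpleGraph V}

theorem ForcesSC.isSelfComplementary (hG : ForcesSC G) : IsSelfComplementary G :=
  hG G fun _ => rfl

theorem ForcesSC.of_iso {W : Type*} [Fintype W] {F : SimpleGraph W} (e : G ≃g F)
    (hG : ForcesSC G) : ForcesSC F := by
  intro F' hF'
  let e' : F'.comap e ≃g F' := SimpleGraph.Iso.comap e.toEquiv F'
  refine (hG _ fun v => ?_).of_iso e'.symm
  rw [← e.degree_eq v, ← hF' (e v)]
  exact (e'.degree_eq v).symm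

theorem degree_antimorphism (σ : G ≃g Gᶜ) (v : V) :
    G.degree (σ v) + G.degree v + 1 = Fintype.card V := by
  have hσ : Gᶜ.degree (σ v) = G.degree v := by convert σ.degree_eq v
  have := G.degree_compl (σ v)
  have := G.degree_lt_card_verts (σ v)
  lia

end Degree

/-! ### Switches -/

/-- The pairs `p q` and `r s` are edges of `G` while `q r` and `s p` are pairs of distinct
non-adjacent vertices. -/
structure IsAlternatingFourCycle {V : Type*} (G : SimpleGraph V) (p q r s : V) : Prop where
  adj_fst : G.Adj p q
  adj_snd : G.Adj r s
  ne_fst : q ≠ r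
  ne_snd : s ≠ p
  not_adj_fst : ¬ G.Adj q r
  not_adj_snd : ¬ G.Adj s p

/-- The graph obtained from `G` by replacing the edges `p q` and `r s` by `q r` and `s p`. -/
def switch {V : Type*} (G : SimpleGraph V) (p q r s : V) : SimpleGraph V :=
  G \ (SimpleGraph.edge p q ⊔ SimpleGraph.edge r s) ⊔
    (SimpleGraph.edge q r ⊔ SimpleGraph.edge s p)

section Switch

variable {V : Type*} {G : SimpleGraph V} {p q r s u w x : V}

theorem IsAlternatingFourCycle.rotate (h : IsAlternatingFourCycle G p q r s) :
    IsAlternatingFourCycle G r s p q :=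
  ⟨h.adj_snd, h.adj_fst, h.ne_snd, h.ne_fst, h.not_adj_snd, h.not_adj_fst⟩

theorem IsAlternatingFourCycle.reverse (h : IsAlternatingFourCycle G p q r s) :
    IsAlternatingFourCycle G q p s r :=
  ⟨h.adj_fst.symm, h.adj_snd.symm, h.ne_snd.symm, h.ne_fst.symm,
    fun h' => h.not_adj_snd h'.symm, fun h' => h.not_adj_fst h'.symm⟩

theorem switch_rotate : switch G r s p q = switch G p q r s := by
  rw [switch, switch, sup_comm (SimpleGraph.edge r s), sup_comm (SimpleGraph.edge s p)]

theorem switch_reverse : switch G q p s r = switch G p q r s := by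
  simp only [switch, SimpleGraph.edge_comm q p, SimpleGraph.edge_comm s r,
    SimpleGraph.edge_comm p s, SimpleGraph.edge_comm r q, sup_comm (SimpleGraph.edge s p)]

theorem IsAlternatingFourCycle.switch_adj_iff (h : IsAlternatingFourCycle G p q r s) (v w : V) :
    (switch G p q r s).Adj v w ↔
      G.Adj v w ∧ s(v, w) ≠ s(p, q) ∧ s(v, w) ≠ s(r, s) ∨
        s(v, w) = s(q, r) ∨ s(v, w) = s(s, p) := by
  have := h.adj_fst.ne
  have := h.adj_snd.ne
  have := h.ne_fst
  have := h.ne_snd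
  simp only [switch, SimpleGraph.sup_adj, SimpleGraph.sdiff_adj, SimpleGraph.edge_adj,
    ne_eq, Sym2.eq_iff]
  grind (splits := 20)

variable [Fintype V]

theorem IsAlternatingFourCycle.neighborFinset_switch (h : IsAlternatingFourCycle G p q r s) :
    (switch G p q r s).neighborFinset p = insert s ((G.neighborFinset p).erase q) := by
  have := h.adj_fst.ne
  have := h.ne_snd
  have hpr : p ≠ r := fun hpr => h.not_adj_snd (hpr ▸ h.adj_snd.symm)
  ext v
  simp only [SimpleGraph.mem_neighborFinset, h.switch_adj_iff, mem_insert, mem_erase]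
  grind

theorem IsAlternatingFourCycle.degree_switch_self (h : IsAlternatingFourCycle G p q r s) :
    (switch G p q r s).degree p = G.degree p := by
  have hs : s ∉ (G.neighborFinset p).erase q := by
    simpa using fun _ hps => h.not_adj_snd hps.symm
  have hq : q ∈ G.neighborFinset p := by simpa using h.adj_fst
  rw [← SimpleGraph.card_neighborFinset_eq_degree, h.neighborFinset_switch,
    card_insert_of_notMem hs, card_erase_add_one hq, SimpleGraph.card_neighborFinset_eq_degree]

theorem IsAlternatingFourCycle.sameDegrees_switch (h : IsAlternatingFourCycle G p q r s) :
    SameDegrees (switch G p q r s) G := by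
  intro v
  rcases eq_or_ne v p with rfl | hp
  · exact h.degree_switch_self
  rcases eq_or_ne v q with rfl | hq
  · rw [← switch_reverse]
    exact h.reverse.degree_switch_self
  rcases eq_or_ne v r with rfl | hr
  · rw [← switch_rotate]
    exact h.rotate.degree_switch_self
  rcases eq_or_ne v s with rfl | hs
  · rw [← switch_rotate, ← switch_reverse]
    exact h.rotate.reverse.degree_switch_self
  rw [degree_eq_card_filter, degree_eq_card_filter]
  congr 1
  ext w
  simp only [mem_filter_univ, h.switch_adj_iff]
  grind

theorem exists_isAlternatingFourCycle_of_degree_lt (hux : G.Adj u x) (huw : ¬ G.Adj u w)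
    (hwu : w ≠ u) (hd : G.degree x < G.degree w) : ∃ z, IsAlternatingFourCycle G u x z w := by
  have hcard : #((G.neighborFinset x).erase w) < #((G.neighborFinset w).erase x) := by
    have := G.card_neighborFinset_eq_degree x
    have := G.card_neighborFinset_eq_degree w
    grind [card_erase_eq_ite, SimpleGraph.mem_neighborFinset, SimpleGraph.adj_comm,
      card_pos, SimpleGraph.mem_neighborFinset]
  obtain ⟨z, hzw, hzx⟩ := exists_mem_notMem_of_card_lt_card hcard
  simp only [mem_erase, SimpleGraph.mem_neighborFinset, not_and] at hzw hzx
  exact ⟨z, hux, hzw.2.symm, hzw.1.symm, hwu, hzx hzw.2.ne', fun h => huw h.symm⟩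

/-- The Havel–Hakimi exchange argument: a realization that maximizes the degree sum of the
neighbours of `u` joins `u` to vertices of large degree first. -/
theorem exists_sameDegrees_adj_of_degree_lt (G : SimpleGraph V) (u : V) :
    ∃ H, SameDegrees H G ∧
      ∀ x w, H.Adj u x → w ≠ u → H.degree x < H.degree w → H.Adj u w := by
  let realizations : Set (SimpleGraph V) := {H | SameDegrees H G}
  obtain ⟨H, hH : SameDegrees H G, hmax⟩ := realizations.toFinite.exists_maximalFor
    (fun H => ∑ v ∈ H.neighborFinset u, G.degree v) realizations ⟨G, fun _ => rfl⟩
  refine ⟨H, hH, fun x w hux hwu hd => by_contra fun huw => ?_⟩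
  obtain ⟨z, h⟩ := exists_isAlternatingFourCycle_of_degree_lt hux huw hwu hd
  have hle := hmax (j := switch H u x z w) (fun v => (h.sameDegrees_switch v).trans (hH v))
  have hx : x ∈ H.neighborFinset u := by simpa using hux
  have hw : w ∉ (H.neighborFinset u).erase x := by simp [huw]
  have hsum := add_sum_erase _ (fun v => G.degree v) hx
  simp only [h.neighborFinset_switch, sum_insert hw] at hle
  rw [hH, hH] at hd
  lia

end Switch

/-! ### Vertex sets interchanged by antimorphisms -/

/-- The antimorphism `σ` interchanges the vertex sets `A` and `B`. -/
structure Swaps {V : Type*} {G : SimpleGraph V} (σ : G ≃g Gᶜ) (A B : Finset V) : Prop where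
  mem_right_iff : ∀ v, σ v ∈ B ↔ v ∈ A
  mem_left_iff : ∀ v, σ v ∈ A ↔ v ∈ B

/-- Every realization of the degrees of `G` has an antimorphism that interchanges `A` and `B`. -/
def ForcesSwap {V : Type*} [Fintype V] (G : SimpleGraph V) (A B : Finset V) : Prop :=
  ∀ H : SimpleGraph V, SameDegrees H G → ∃ σ : H ≃g Hᶜ, Swaps σ A B

/-- All neighbours of `v` lie in `A`. -/
def NeighborsIn {V : Type*} (G : SimpleGraph V) (A : Finset V) (v : V) : Prop :=
  ∀ w, G.Adj v w → w ∈ A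

/-- `v` is adjacent to every other vertex outside `B`. -/
def AdjOutside {V : Type*} (G : SimpleGraph V) (B : Finset V) (v : V) : Prop :=
  ∀ w ∉ B, w ≠ v → G.Adj v w

section Swap

variable {V : Type*} {G : SimpleGraph V} {σ : G ≃g Gᶜ} {A B : Finset V}

theorem Swaps.card_eq (hσ : Swaps σ A B) : #A = #B :=
  card_equiv σ.toEquiv fun v => (hσ.mem_right_iff v).symm

theorem Swaps.neighborsIn_apply (hσ : Swaps σ A B) {v : V} (hv : AdjOutside G B v) :
    NeighborsIn G A (σ v) := by
  intro w hw
  obtain ⟨x, rfl⟩ := σ.surjective w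
  have hxv : x ≠ v := fun h => G.irrefl (h ▸ hw)
  by_contra hx
  exact (antimorphism_adj σ hxv.symm).1 hw (hv x (mt (hσ.mem_left_iff x).2 hx) hxv)

theorem Swaps.adjOutside_apply (hσ : Swaps σ A B) {v : V} (hv : NeighborsIn G A v) :
    AdjOutside G B (σ v) := by
  intro w hw hne
  obtain ⟨x, rfl⟩ := σ.surjective w
  have hxv : x ≠ v := fun h => hne (h ▸ rfl)
  exact (antimorphism_adj σ hxv.symm).2 fun h => hw ((hσ.mem_right_iff x).2 (hv x h))

theorem Swaps.card_filter_not_adj (hσ : Swaps σ A B) {v : V} (hv : v ∉ A) :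
    #{b ∈ B | ¬ G.Adj (σ v) b} = #{a ∈ A | G.Adj v a} := by
  refine (card_equiv σ.toEquiv fun a => ?_).symm
  have (ha : a ∈ A) := antimorphism_adj σ (ne_of_mem_of_not_mem ha hv).symm
  have := hσ.mem_right_iff a
  simp only [mem_filter, RelIso.coe_fn_toEquiv]
  grind

theorem Swaps.exists_not_adj (hσ : Swaps σ A B) (hAB : Disjoint A B) {y : V} (hy : y ∈ B) :
    ∃ a ∈ A, ¬ G.Adj y a := by
  by_contra! h
  obtain ⟨a, rfl⟩ := σ.surjective y
  have ha : a ∈ A := (hσ.mem_right_iff a).1 hy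
  have hne : σ a ≠ a := fun hne => disjoint_left.1 hAB ha (hne ▸ hy)
  have hσa : G.Adj (σ a) (σ (σ a)) := h _ ((hσ.mem_left_iff _).2 hy)
  exact (antimorphism_adj σ hne.symm).1 hσa (h a ha).symm

theorem Swaps.two_mul_card_interedges (hσ : Swaps σ A B) (hAB : Disjoint A B) :
    2 * #(G.interedges B A) = #A * #B := by
  have hcompl : #(G.interedges A B) = #(Gᶜ.interedges B A) := by
    refine card_equiv (σ.toEquiv.prodCongr σ.toEquiv) fun e => ?_
    simp [SimpleGraph.mem_interedges_iff, hσ.mem_left_iff, hσ.mem_right_iff, σ.map_adj_iff]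
  have hcomm : #(G.interedges A B) = #(G.interedges B A) :=
    have := G.symm
    Rel.card_interedges_comm A B
  have := G.card_interedges_add_card_interedges_compl hAB.symm
  lia

theorem card_interedges_eq_sum (G : SimpleGraph V) (A B : Finset V) :
    #(G.interedges B A) = ∑ b ∈ B, #{a ∈ A | G.Adj b a} := by
  simp only [SimpleGraph.interedges, Rel.interedges, card_filter, sum_product]

variable [Fintype V] {δ : ℕ}

theorem ForcesSwap.congr {H : SimpleGraph V} (h : ForcesSwap G A B) (hH : SameDegrees H G) :
    ForcesSwap H A B :=
  fun H' hH' => h H' fun v => (hH' v).trans (hH v)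

theorem ForcesSwap.exists_swaps (h : ForcesSwap G A B) : ∃ σ : G ≃g Gᶜ, Swaps σ A B :=
  h G fun _ => rfl

/-- Such a switch would create an edge between `A` and `B` without destroying one. -/
theorem ForcesSwap.not_isAlternatingFourCycle (h : ForcesSwap G A B) (hAB : Disjoint A B)
    {v w y z : V} (hv : v ∈ A) (hy : y ∈ B) (hw : w ∉ B) (hz : z ∉ A) :
    ¬ IsAlternatingFourCycle G w v y z := by
  intro hcycle
  have hvB : v ∉ B := disjoint_left.1 hAB hv
  have hyA : y ∉ A := disjoint_right.1 hAB hy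
  have hlt : #(G.interedges B A) < #((switch G w v y z).interedges B A) := by
    refine card_lt_card (Finset.ssubset_iff_of_subset ?_ |>.2 ⟨(y, v), ?_, ?_⟩)
    · rintro ⟨b, a⟩ he
      simp only [SimpleGraph.mem_interedges_iff, hcycle.switch_adj_iff, ne_eq, Sym2.eq_iff] at he ⊢
      obtain ⟨hb, ha, hba⟩ := he
      exact ⟨hb, ha, .inl ⟨hba, by grind, by grind⟩⟩
    · simp [SimpleGraph.mem_interedges_iff, hcycle.switch_adj_iff, hy, hv]
    · simpa [SimpleGraph.mem_interedges_iff, hy, hv, G.adj_comm] using hcycle.not_adj_fst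
  obtain ⟨σ, hσ⟩ := h.exists_swaps
  obtain ⟨τ, hτ⟩ := h _ hcycle.sameDegrees_switch
  have := hσ.two_mul_card_interedges hAB
  have := hτ.two_mul_card_interedges hAB
  lia

theorem ForcesSwap.neighborsIn_of_not_adj (h : ForcesSwap G A B) (hAB : Disjoint A B)
    {v y : V} (hv : v ∈ A) (hfull : AdjOutside G B v) (hy : y ∈ B)
    (hvy : ¬ G.Adj v y) (hdeg : ∀ b ∈ B, G.degree b < #A) : NeighborsIn G A y := by
  intro z hyz
  by_contra hzA
  have hyA : y ∉ A := disjoint_right.1 hAB hy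
  have hzv : z ≠ v := (ne_of_mem_of_not_mem hv hzA).symm
  have hz (w : V) (hwB : w ∉ B) (hwv : w ≠ v) (hwz : w ≠ z) : G.Adj z w := by
    by_contra hzw
    exact h.not_isAlternatingFourCycle hAB hv hy hwB hzA
      ⟨(hfull w hwB hwv).symm, hyz, (ne_of_mem_of_not_mem hv hyA), hwz.symm, hvy, hzw⟩
  by_cases hzB : z ∈ B
  · have hsub : insert y (A.erase v) ⊆ G.neighborFinset z := by
      refine insert_subset (by simpa using hyz.symm) fun a ha => ?_
      obtain ⟨hav, ha⟩ := mem_erase.1 ha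
      simpa using hz a (disjoint_left.1 hAB ha) hav (ne_of_mem_of_not_mem ha hzA)
    have hcard := card_le_card hsub
    rw [card_insert_of_notMem (by simp [hyA]), card_erase_add_one hv,
      SimpleGraph.card_neighborFinset_eq_degree] at hcard
    exact (hdeg z hzB).not_ge hcard
  · have hzfull : AdjOutside G B z := by
      intro w hwB hwz
      rcases eq_or_ne w v with rfl | hwv
      exacts [(hfull z hzB hzv).symm, hz w hwB hwv hwz]
    obtain ⟨σ, hσ⟩ := h.exists_swaps
    have hσz := hσ.neighborsIn_apply hzfull
    rcases eq_or_ne (σ z) z with hfix | hne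
    · exact hyA (hσz y (by rw [hfix]; exact hyz.symm))
    · exact hzA (hσz z (hzfull _ (mt (hσ.mem_right_iff z).1 hzA) hne).symm)

theorem NeighborsIn.card_filter_adj {v : V} (hv : NeighborsIn G A v) :
    #{a ∈ A | G.Adj v a} = G.degree v := by
  rw [degree_eq_card_filter]
  congr 1
  ext a
  simpa using hv a

theorem ForcesSwap.neighborsIn_of_exists (h : ForcesSwap G A B) (hAB : Disjoint A B)
    (hdeg : ∀ b ∈ B, G.degree b = δ) (hδ : δ < #A) {y : V} (hy : y ∈ B)
    (hyA : NeighborsIn G A y) {y' : V} (hy' : y' ∈ B) : NeighborsIn G A y' := by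
  obtain ⟨σ, hσ⟩ := h.exists_swaps
  have hlt : ∀ b ∈ B, G.degree b < #A := fun b hb => (hdeg b hb).trans_lt hδ
  have hσmem {b : V} (hb : b ∈ B) : σ b ∈ A := (hσ.mem_left_iff b).2 hb
  let P : Finset V := {b ∈ B | ¬ G.Adj (σ y) b}
  have hPcard : #P = δ := by
    rw [hσ.card_filter_not_adj (disjoint_right.1 hAB hy), hyA.card_filter_adj, hdeg y hy]
  have hP {b : V} (hb : b ∈ P) : b ∈ B ∧ NeighborsIn G A b := by
    obtain ⟨hbB, hyb⟩ := mem_filter.1 hb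
    exact ⟨hbB, h.neighborsIn_of_not_adj hAB (hσmem hy) (hσ.adjOutside_apply hyA) hbB hyb hlt⟩
  intro z hz
  by_contra hzA
  have hadj {b : V} (hb : b ∈ P) : G.Adj (σ b) y' := by
    by_contra hby'
    exact hzA (h.neighborsIn_of_not_adj hAB (hσmem (hP hb).1) (hσ.adjOutside_apply (hP hb).2)
      hy' hby' hlt z hz)
  have hzP : z ∉ P.image σ := fun hzP => by
    obtain ⟨b, hb, rfl⟩ := mem_image.1 hzP
    exact hzA (hσmem (hP hb).1)
  have hsub : insert z (P.image σ) ⊆ G.neighborFinset y' :=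
    insert_subset (by simpa using hz) (image_subset_iff.2 fun b hb => by simpa using (hadj hb).symm)
  have hcard := card_le_card hsub
  rw [card_insert_of_notMem hzP, card_image_of_injective _ σ.injective, hPcard,
    SimpleGraph.card_neighborFinset_eq_degree, hdeg y' hy'] at hcard
  lia

theorem ForcesSwap.exists_sameDegrees_neighborsIn (h : ForcesSwap G A B) (hAB : Disjoint A B)
    (hA : ∀ a ∈ A, ∀ x ∉ A, G.degree x < G.degree a) {y : V} (hy : y ∈ B) :
    ∃ H, SameDegrees H G ∧ NeighborsIn H A y := by
  obtain ⟨H, hH, hgreedy⟩ := exists_sameDegrees_adj_of_degree_lt G y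
  refine ⟨H, hH, fun z hz => by_contra fun hzA => ?_⟩
  obtain ⟨σ, hσ⟩ := h H hH
  obtain ⟨a, ha, hya⟩ := hσ.exists_not_adj hAB hy
  have hdeg : H.degree z < H.degree a := by simpa only [hH _] using hA a ha z hzA
  exact hya (hgreedy z a hz (ne_of_mem_of_not_mem ha (disjoint_right.1 hAB hy)) hdeg)

theorem Swaps.degree_lt_card (hσ : Swaps σ A B) (hAB : Disjoint A B) {y : V} (hy : y ∈ B)
    (hyA : NeighborsIn G A y) : G.degree y < #A := by
  obtain ⟨a, ha, hya⟩ := hσ.exists_not_adj hAB hy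
  rw [← hyA.card_filter_adj]
  exact card_lt_card (filter_ssubset.2 ⟨a, ha, hya⟩)

theorem ForcesSwap.two_mul_degree_eq_card (h : ForcesSwap G A B) (hAB : Disjoint A B)
    (hA : ∀ a ∈ A, ∀ x ∉ A, G.degree x < G.degree a) (hdeg : ∀ b ∈ B, G.degree b = δ)
    (hB : B.Nonempty) : 2 * δ = #A := by
  obtain ⟨y, hy⟩ := hB
  obtain ⟨H, hH, hyA⟩ := h.exists_sameDegrees_neighborsIn hAB hA hy
  obtain ⟨σ, hσ⟩ := h H hH
  have hdegH : ∀ b ∈ B, H.degree b = δ := fun b hb => (hH b).trans (hdeg b hb)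
  have hδ : δ < #A := hdegH y hy ▸ hσ.degree_lt_card hAB hy hyA
  have hedges : #(H.interedges B A) = #B * δ := by
    rw [card_interedges_eq_sum]
    refine sum_const_nat fun b hb => ?_
    rw [((h.congr hH).neighborsIn_of_exists hAB hdegH hδ hy hyA hb).card_filter_adj, hdegH b hb]
  have htwo := hσ.two_mul_card_interedges hAB
  rw [hedges, ← mul_left_comm, mul_comm #A] at htwo
  exact Nat.eq_of_mul_eq_mul_left (card_pos.2 ⟨y, hy⟩) htwo

/-- Counting edges between `A` and `B` shows that `2 * δ = #A`, which leaves the vertices of `B`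
no edges to spare. -/
theorem ForcesSwap.neighborsIn (h : ForcesSwap G A B) (hAB : Disjoint A B)
    (hA : ∀ a ∈ A, ∀ x ∉ A, G.degree x < G.degree a) (hdeg : ∀ b ∈ B, G.degree b = δ)
    {y : V} (hy : y ∈ B) : NeighborsIn G A y := by
  obtain ⟨σ, hσ⟩ := h.exists_swaps
  have hδ := h.two_mul_degree_eq_card hAB hA hdeg ⟨y, hy⟩
  have hsub (b : V) : ({a ∈ A | G.Adj b a} : Finset V) ⊆ univ.filter fun a => G.Adj b a :=
    filter_subset_filter _ (subset_univ A)
  have hle : ∀ b ∈ B, #{a ∈ A | G.Adj b a} ≤ δ := fun b hb => by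
    rw [← hdeg b hb, degree_eq_card_filter]
    exact card_le_card (hsub b)
  have hsum : ∑ b ∈ B, #{a ∈ A | G.Adj b a} = ∑ _b ∈ B, δ := by
    have := hσ.two_mul_card_interedges hAB
    rw [← card_interedges_eq_sum, sum_const, smul_eq_mul]
    grind
  have hcard := (sum_eq_sum_iff_of_le hle).1 hsum y hy
  rw [← hdeg y hy, degree_eq_card_filter] at hcard
  intro a ha
  have : a ∈ ({a ∈ A | G.Adj y a} : Finset V) := by
    rw [eq_of_subset_of_card_le (hsub y) hcard.ge]
    simpa using ha
  exact (mem_filter.1 this).1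

end Swap

section ExtremalDegree

variable {V : Type*} [Fintype V] {G H : SimpleGraph V}

/-- The vertices of maximum degree. -/
noncomputable def maxDegreeFinset (G : SimpleGraph V) : Finset V :=
  {v | ∀ w, G.degree w ≤ G.degree v}

/-- The vertices of minimum degree. -/
noncomputable def minDegreeFinset (G : SimpleGraph V) : Finset V :=
  {v | ∀ w, G.degree v ≤ G.degree w}

theorem mem_maxDegreeFinset {v : V} : v ∈ maxDegreeFinset G ↔ ∀ w, G.degree w ≤ G.degree v :=
  mem_filter_univ v

theorem mem_minDegreeFinset {v : V} : v ∈ minDegreeFinset G ↔ ∀ w, G.degree v ≤ G.degree w :=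
  mem_filter_univ v

theorem swaps_maxDegreeFinset_minDegreeFinset (σ : G ≃g Gᶜ) :
    Swaps σ (maxDegreeFinset G) (minDegreeFinset G) := by
  have hσ := degree_antimorphism σ
  constructor <;> intro v <;>
    rw [mem_maxDegreeFinset, mem_minDegreeFinset, σ.surjective.forall] <;>
    refine forall_congr' fun w => ?_ <;> grind

theorem ForcesSC.forcesSwap (hG : ForcesSC G) :
    ForcesSwap G (maxDegreeFinset G) (minDegreeFinset G) := by
  intro H hH
  obtain ⟨σ⟩ := hG H hH
  have hmax : maxDegreeFinset H = maxDegreeFinset G := by simp only [maxDegreeFinset, hH _]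
  have hmin : minDegreeFinset H = minDegreeFinset G := by simp only [minDegreeFinset, hH _]
  exact ⟨σ, hmax ▸ hmin ▸ swaps_maxDegreeFinset_minDegreeFinset σ⟩

theorem disjoint_maxDegreeFinset_minDegreeFinset (hG : ¬ ∃ k, G.IsRegularOfDegree k) :
    Disjoint (maxDegreeFinset G) (minDegreeFinset G) := by
  refine disjoint_left.2 fun v hmax hmin => hG ⟨G.degree v, fun w => ?_⟩
  exact (mem_maxDegreeFinset.1 hmax w).antisymm (mem_minDegreeFinset.1 hmin w)

theorem maxDegreeFinset_nonempty [Nonempty V] : (maxDegreeFinset G).Nonempty := by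
  obtain ⟨v, hv⟩ := Finite.exists_max fun v => G.degree v
  exact ⟨v, mem_maxDegreeFinset.2 hv⟩

theorem degree_lt_of_mem_maxDegreeFinset {v w : V} (hv : v ∈ maxDegreeFinset G)
    (hw : w ∉ maxDegreeFinset G) : G.degree w < G.degree v := by
  rw [mem_maxDegreeFinset] at hv hw
  push Not at hw
  obtain ⟨x, hx⟩ := hw
  exact hx.trans_le (hv x)

end ExtremalDegree

section Induce

variable {V : Type*} {G : SimpleGraph V} {T : Set V}

/-- The graph obtained from `G` by replacing its restriction to `T` by `F`. -/
def replaceInduce (G : SimpleGraph V) (T : Set V) (F : SimpleGraph T) : SimpleGraph V where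
  Adj x y := if h : x ∈ T ∧ y ∈ T then F.Adj ⟨x, h.1⟩ ⟨y, h.2⟩ else G.Adj x y
  symm := ⟨fun x y h => by
    split_ifs at h ⊢ <;> simp_all [F.adj_comm, G.adj_comm]⟩
  loopless := ⟨fun x h => by simp at h⟩

theorem replaceInduce_adj_coe (F : SimpleGraph T) (x y : T) :
    (replaceInduce G T F).Adj x y ↔ F.Adj x y := by
  simp [replaceInduce]

theorem replaceInduce_adj_of_notMem (F : SimpleGraph T) (x : V) {y : V} (hy : y ∉ T) :
    (replaceInduce G T F).Adj x y ↔ G.Adj x y := by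
  simp [replaceInduce, hy]

theorem replaceInduce_adj_of_notMem_left (F : SimpleGraph T) {x : V} (hx : x ∉ T) (y : V) :
    (replaceInduce G T F).Adj x y ↔ G.Adj x y := by
  simp [replaceInduce, hx]

variable [Fintype V]

theorem degree_eq_degree_add {F : SimpleGraph T} (hF : ∀ x y : T, F.Adj x y ↔ G.Adj x y) (v : T) :
    G.degree v = F.degree v + #{w | w ∉ T ∧ G.Adj v w} := by
  have hT : F.degree v = #{w | w ∈ T ∧ G.Adj v w} := by
    rw [degree_eq_card_filter, ← card_map (.subtype _)]
    congr 1
    ext w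
    simp [hF, and_comm]
  rw [hT, degree_eq_card_filter, ← card_filter_add_card_filter_not (· ∈ T), filter_filter,
    filter_filter]
  simp only [and_comm]

theorem sameDegrees_replaceInduce {F : SimpleGraph T} (hF : SameDegrees F (G.induce T)) :
    SameDegrees (replaceInduce G T F) G := by
  intro v
  by_cases hv : v ∈ T
  · lift v to T using hv
    rw [degree_eq_degree_add (fun x y => (replaceInduce_adj_coe F x y).symm) v,
      degree_eq_degree_add (G := G) (F := G.induce T) (fun _ _ => Iff.rfl) v, hF v]
    congr 2
    ext w
    simp +contextual [replaceInduce_adj_of_notMem]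
  · simp only [degree_eq_card_filter, replaceInduce_adj_of_notMem_left F hv]

theorem ForcesSC.induce_of_mem_iff
    (h : ∀ H, SameDegrees H G → ∃ σ : H ≃g Hᶜ, ∀ v, σ v ∈ T ↔ v ∈ T) :
    ForcesSC (G.induce T) := by
  intro F hF
  obtain ⟨σ, hσ⟩ := h _ (sameDegrees_replaceInduce hF)
  refine ⟨⟨σ.toEquiv.subtypeEquiv fun v => (hσ v).symm, fun {x y} => ?_⟩⟩
  have hiff := σ.map_adj_iff (v := x) (w := y)
  rw [replaceInduce_adj_coe] at hiff
  rw [← hiff, SimpleGraph.compl_adj, SimpleGraph.compl_adj, ← replaceInduce_adj_coe (G := G)]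
  simp [Subtype.ext_iff]

end Induce

/-! ### Recognizing the blocks -/

/-- Every row and every column of the `0`-`1` matrix of `r` has sum `k`. -/
structure IsBiregular {A B : Type*} [Fintype A] [Fintype B] (r : A → B → Prop) (k : ℕ) : Prop where
  card_row : ∀ a, #{b | r a b} = k
  card_column : ∀ b, #{a | r a b} = k

section IsBiregular

variable {A B : Type*} [Fintype A] [Fintype B] {r : A → B → Prop} {k : ℕ}

theorem IsBiregular.exists_equiv (h : IsBiregular r (k + 1)) : ∃ e : A ≃ B, ∀ a, r a (e a) := by
  have hle {s : Finset A} {t : Finset B} (hst : ∀ a ∈ s, ∀ b, r a b → b ∈ t) : #s ≤ #t := by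
    refine Nat.le_of_mul_le_mul_right (card_mul_le_card_mul r (m := k + 1) (n := k + 1)
      (fun a ha => ?_) fun b _ => ?_) k.succ_pos
    · rw [← h.card_row a]
      exact card_le_card fun b hb => by
        simp_all [bipartiteAbove, hst a ha b]
    · rw [← h.card_column b]
      exact card_le_card (filter_subset_filter _ (subset_univ s))
  obtain ⟨f, hf, hr⟩ := (Fintype.all_card_le_filter_rel_iff_exists_injective r).1
    fun s => hle fun a ha b hab => by simpa using ⟨a, ha, hab⟩
  have hcard : Fintype.card B ≤ Fintype.card A := by
    refine Nat.le_of_mul_le_mul_right (card_mul_le_card_mul' r (s := univ) (t := univ)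
      (m := k + 1) (n := k + 1) (fun b _ => (h.card_column b).ge) fun a _ => (h.card_row a).le)
      k.succ_pos
  exact ⟨.ofBijective f ((Fintype.bijective_iff_injective_and_card f).2
    ⟨hf, (Fintype.card_le_of_injective f hf).antisymm hcard⟩), hr⟩

theorem IsBiregular.remove_equiv (h : IsBiregular r (k + 1)) {e : A ≃ B} (he : ∀ a, r a (e a)) :
    IsBiregular (fun a b => r a b ∧ e a ≠ b) k := by
  constructor
  · intro a
    trans #(({b | r a b} : Finset B).erase (e a))
    · congr 1
      ext
      simp [and_comm, eq_comm]
    rw [card_erase_of_mem (by simpa using he a), h.card_row, Nat.add_sub_cancel]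
  · intro b
    trans #(({a | r a b} : Finset A).erase (e.symm b))
    · congr 1
      ext
      simp [and_comm, e.eq_symm_apply]
    rw [card_erase_of_mem (by simpa using he (e.symm b)), h.card_column, Nat.add_sub_cancel]

theorem IsBiregular.not_of_zero (h : IsBiregular r 0) (a : A) (b : B) : ¬ r a b := by
  have := card_eq_zero.1 (h.card_row a)
  simpa using filter_eq_empty_iff.1 this (mem_univ b)

theorem IsBiregular.exists_iff_apply_eq (h : IsBiregular r 1) :
    ∃ e : A ≃ B, ∀ a b, r a b ↔ e a = b := by
  obtain ⟨e, he⟩ := h.exists_equiv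
  refine ⟨e, fun a b => ⟨fun hab => ?_, fun hab => hab ▸ he a⟩⟩
  by_contra hne
  exact (h.remove_equiv he).not_of_zero a b ⟨hab, hne⟩

theorem IsBiregular.exists_iff_apply_eq_or (h : IsBiregular r 2) :
    ∃ e f : A ≃ B, (∀ a, e a ≠ f a) ∧ ∀ a b, r a b ↔ e a = b ∨ f a = b := by
  obtain ⟨e, he⟩ := h.exists_equiv
  obtain ⟨f, hf⟩ := (h.remove_equiv he).exists_iff_apply_eq
  refine ⟨e, f, fun a => ((hf a _).2 rfl).2, fun a b => ?_⟩
  rw [← hf]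
  have : e a = b → r a b := fun h => h ▸ he a
  tauto

end IsBiregular

section Block

variable {A B : Type} [Fintype A] [Fintype B] {r r' : A → B → Prop} {k : ℕ}

theorem isBlock_splitGraph_of_isBiregular_one (hA : Fintype.card A = 2) (h : IsBiregular r 1) :
    IsBlock (splitGraph r) := by
  obtain ⟨e, he⟩ := h.exists_iff_apply_eq
  let x : A ≃ Fin 2 := Fintype.equivFinOfCardEq hA
  exact .inl ⟨(splitGraphCongr x (e.symm.trans x) fun a b => by
    simp [he, e.eq_symm_apply]).trans pathGraphFourIso.symm⟩

theorem exists_perm_of_derangement_fin_four : ∀ s : Equiv.Perm (Fin 4), (∀ i, i ≠ s i) →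
    (∃ e : Equiv.Perm (Fin 4), ∀ i, e (s i) = e i + 1) ∨
      ∃ e : Equiv.Perm (Fin 4), ∀ i j, (e i).val / 2 = (e j).val / 2 ↔ i = j ∨ s i = j := by
  set_option maxRecDepth 100000 in decide

theorem isBlock_splitGraph_of_isBiregular_two (hA : Fintype.card A = 4) (h : IsBiregular r 2) :
    IsBlock (splitGraph r) := by
  obtain ⟨f, g, hne, hfg⟩ := h.exists_iff_apply_eq_or
  let x : A ≃ Fin 4 := Fintype.equivFinOfCardEq hA
  let s : Equiv.Perm (Fin 4) := (x.symm.trans g).trans (f.symm.trans x)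
  have hs (i : Fin 4) : i ≠ s i := by
    simpa [s, ← x.symm_apply_eq, f.eq_symm_apply] using hne (x.symm i)
  have hr (a : A) (b : B) : r a b ↔ x a = x (f.symm b) ∨ s (x a) = x (f.symm b) := by
    simp [hfg, s, f.eq_symm_apply]
  refine .inr ((exists_perm_of_derangement_fin_four s hs).imp ?_ ?_)
  · rintro ⟨e, he⟩
    exact ⟨splitGraphCongr (x.trans e) ((f.symm.trans x).trans e) fun a b => by
      simp [hr, ← he, eq_comm]⟩
  · rintro ⟨e, he⟩
    exact ⟨splitGraphCongr (x.trans e) ((f.symm.trans x).trans e) fun a b => by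
      simp [hr, he]⟩

theorem card_filter_sum {p : A ⊕ B → Prop} {q : A → Prop} {s : B → Prop}
    (hq : ∀ a, p (.inl a) ↔ q a) (hs : ∀ b, p (.inr b) ↔ s b) :
    #{x | p x} = #{a | q a} + #{b | s b} := by
  simp only [card_filter, Fintype.sum_sum_type, hq, hs]

theorem degree_splitGraph_inl (a : A) :
    (splitGraph r).degree (.inl a) = #{x | a ≠ x} + #{b | r a b} := by
  rw [degree_eq_card_filter]
  convert card_filter_sum (p := (splitGraph r).Adj (.inl a)) (q := (a ≠ ·)) (s := (r a ·))
    (fun _ => .rfl) fun _ => .rfl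

theorem degree_splitGraph_inr (b : B) : (splitGraph r).degree (.inr b) = #{a | r a b} := by
  rw [degree_eq_card_filter, card_filter_sum (q := (r · b)) (s := fun _ => False)
    (fun _ => .rfl) fun _ => .rfl]
  simp

theorem IsBiregular.sameDegrees_splitGraph (h : IsBiregular r k) (h' : IsBiregular r' k) :
    SameDegrees (splitGraph r') (splitGraph r) := by
  rintro (a | b)
  · rw [degree_splitGraph_inl, degree_splitGraph_inl, h.card_row, h'.card_row]
  · rw [degree_splitGraph_inr, degree_splitGraph_inr, h.card_column, h'.card_column]

/-- A relation with constant row and column sums in which the rows `Sum.inr k`, `k ≠ o`, coincide,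
whereas no two columns coincide. -/
def unbalanced {α : Type} (o : α) : α ⊕ α → α ⊕ α → Prop
  | .inl i, .inl j => i = j
  | .inl i, .inr j => i ≠ j
  | .inr i, .inl _ => i ≠ o
  | .inr i, .inr _ => i = o

theorem isBiregular_unbalanced {α : Type} [Fintype α] (o : α) :
    IsBiregular (unbalanced o) (Fintype.card α) := by
  have hadd {p q : α → Prop} {c d : α} (hp : ∀ i, p i ↔ i = c) (hq : ∀ i, q i ↔ i ≠ d) :
      #{i | p i} + #{i | q i} = Fintype.card α := by
    have hone : #{i | p i} = 1 := card_eq_one.2 ⟨c, by ext; simp [hp]⟩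
    have herase : ({i | q i} : Finset α) = univ.erase d := by ext; simp [hq]
    rw [hone, herase, add_comm, card_erase_add_one (mem_univ d), card_univ]
  constructor <;> rintro (i | i) <;> rw [card_filter_sum (fun _ => .rfl) fun _ => .rfl]
  · exact hadd (fun _ => eq_comm) fun _ => ne_comm
  · by_cases h : i = o <;> simp [unbalanced, h]
  · exact hadd (fun _ => .rfl) fun _ => .rfl
  · rw [add_comm]
    exact hadd (fun _ => .rfl) fun _ => .rfl

theorem unbalanced_column_injective {α : Type} (o : α) {x y : α ⊕ α}
    (h : ∀ z, unbalanced o z x ↔ unbalanced o z y) : x = y := by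
  rcases x with i | i <;> rcases y with j | j
  · simpa [unbalanced] using h (.inl i)
  · simpa [unbalanced] using h (.inr o)
  · simpa [unbalanced] using h (.inr o)
  · simpa [unbalanced, eq_comm] using h (.inl i)

theorem eq_of_adj_iff_splitGraph_unbalanced {α : Type} [Finite α] (o : α)
    {x y : (α ⊕ α) ⊕ (α ⊕ α)}
    (h : ∀ z, (splitGraph (unbalanced o)).Adj x z ↔ (splitGraph (unbalanced o)).Adj y z) :
    x = y := by
  have := Fintype.ofFinite α
  have hdeg (a b) : (splitGraph (unbalanced o)).degree (.inr b) <
      (splitGraph (unbalanced o)).degree (.inl a) := by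
    rw [degree_splitGraph_inl, degree_splitGraph_inr, (isBiregular_unbalanced o).card_row,
      (isBiregular_unbalanced o).card_column, Nat.lt_add_left_iff_pos, card_pos]
    exact ⟨a.swap, by cases a <;> simp⟩
  have heq : (splitGraph (unbalanced o)).degree x = (splitGraph (unbalanced o)).degree y := by
    simp only [degree_eq_card_filter, h]
  rcases x with a | b <;> rcases y with a' | b'
  · simpa [splitGraph] using h (.inl a')
  · exact absurd heq (hdeg a b').ne'
  · exact absurd heq (hdeg a' b).ne
  · exact congrArg Sum.inr (unbalanced_column_injective o fun z => h (.inl z))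

/-- In the complement two vertices have the same neighbours. -/
theorem not_isSelfComplementary_splitGraph_unbalanced {α : Type} [Fintype α] (o : α)
    (hα : 2 < Fintype.card α) : ¬ IsSelfComplementary (splitGraph (unbalanced o)) := by
  rintro ⟨σ⟩
  obtain ⟨k, hk, l, hl, hkl⟩ : ∃ k ∈ univ.erase o, ∃ l ∈ univ.erase o, k ≠ l := by
    rw [← one_lt_card, card_erase_of_mem (mem_univ o), card_univ]
    lia
  have htwin (z) : (splitGraph (unbalanced o))ᶜ.Adj (.inl (.inr k)) z ↔
      (splitGraph (unbalanced o))ᶜ.Adj (.inl (.inr l)) z := by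
    have hko := ne_of_mem_erase hk
    have hlo := ne_of_mem_erase hl
    rcases z with a | (b | b) <;> simp [splitGraph, unbalanced, hko, hlo]
  have := σ.symm.injective (eq_of_adj_iff_splitGraph_unbalanced o fun z => by
    simpa only [← σ.map_adj_iff, σ.apply_symm_apply] using htwin (σ z))
  simp [hkl] at this

theorem ForcesSC.card_le_two {α : Type} [Fintype α] {r : α ⊕ α → α ⊕ α → Prop}
    (h : ForcesSC (splitGraph r)) (hr : IsBiregular r (Fintype.card α)) : Fintype.card α ≤ 2 := by
  by_contra! hα
  obtain ⟨o⟩ : Nonempty α := Fintype.card_pos_iff.1 (by lia)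
  exact not_isSelfComplementary_splitGraph_unbalanced o hα
    (h _ (hr.sameDegrees_splitGraph (isBiregular_unbalanced o)))

theorem ForcesSC.isBlock_splitGraph {α : Type} [Fintype α] [Nonempty α] {r : α ⊕ α → α ⊕ α → Prop}
    (h : ForcesSC (splitGraph r)) (hr : IsBiregular r (Fintype.card α)) :
    IsBlock (splitGraph r) := by
  have hsum : Fintype.card (α ⊕ α) = Fintype.card α + Fintype.card α := Fintype.card_sum
  have hpos : 0 < Fintype.card α := Fintype.card_pos
  have hle := h.card_le_two hr
  generalize Fintype.card α = m at *
  interval_cases m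
  exacts [isBlock_splitGraph_of_isBiregular_one hsum hr,
    isBlock_splitGraph_of_isBiregular_two hsum hr]

end Block

/-! ### Regular graphs -/

/-- The complete bipartite graph with sides `Bool × (ι ⊕ ι)` in which the matching on the vertices
`Sum.inl i` is replaced by edges from its ends to a new vertex `none`. -/
def apexBipartite (ι : Type*) : SimpleGraph (Option (Bool × (ι ⊕ ι))) where
  Adj
    | none, none => False
    | none, some (_, y) => y.isLeft
    | some (_, x), none => x.isLeft
    | some (b, x), some (c, y) => b ≠ c ∧ ¬ (x = y ∧ x.isLeft)
  symm := ⟨by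
    rintro (_ | ⟨b, x⟩) (_ | ⟨c, y⟩) h
    exacts [h, h, h, ⟨h.1.symm, fun h' => h.2 ⟨h'.1.symm, h'.1 ▸ h'.2⟩⟩]⟩
  loopless := ⟨by
    rintro (_ | ⟨b, x⟩) h
    exacts [h, h.1 rfl]⟩

section Regular

variable {ι : Type*} [Fintype ι]

theorem isRegularOfDegree_apexBipartite :
    (apexBipartite ι).IsRegularOfDegree (2 * Fintype.card ι) := by
  have hinj (b : Bool) : Function.Injective fun y : ι ⊕ ι => some (b, y) := fun y z h => by
    simpa using h
  rintro (_ | ⟨b, i | i⟩) <;> rw [← SimpleGraph.card_neighborFinset_eq_degree]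
  · have hN : (apexBipartite ι).neighborFinset none =
        univ.image fun x : Bool × ι => some (x.1, Sum.inl x.2) := by
      ext (_ | ⟨c, j | j⟩) <;> rw [SimpleGraph.mem_neighborFinset] <;> simp [apexBipartite]
    rw [hN, card_image_of_injective _ (by rintro ⟨c, j⟩ ⟨d, l⟩ h; simpa using h)]
    simp
  · have hN : (apexBipartite ι).neighborFinset (some (b, .inl i)) =
        insert none ((univ.erase (.inl i)).image fun y => some (!b, y)) := by
      ext (_ | ⟨_ | _, j | j⟩) <;> rw [SimpleGraph.mem_neighborFinset] <;> cases b <;>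
        simp [apexBipartite, eq_comm (a := i)]
    rw [hN, card_insert_of_notMem (by simp), card_image_of_injective _ (hinj _),
      card_erase_add_one (mem_univ _)]
    simp [two_mul]
  · have hN : (apexBipartite ι).neighborFinset (some (b, .inr i)) =
        univ.image fun y => some (!b, y) := by
      ext (_ | ⟨_ | _, j | j⟩) <;> rw [SimpleGraph.mem_neighborFinset] <;> cases b <;>
        simp [apexBipartite]
    rw [hN, card_image_of_injective _ (hinj _)]
    simp [two_mul]

theorem not_isSelfComplementary_apexBipartite (hι : 1 < Fintype.card ι) :
    ¬ IsSelfComplementary (apexBipartite ι) := by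
  rintro ⟨σ⟩
  let color : (apexBipartite ι).Coloring (Option Bool) := .mk (Option.map Prod.fst) (by
    rintro (_ | ⟨b, x⟩) (_ | ⟨c, y⟩) h
    exacts [h.elim, by simp, by simp, by simpa using h.1])
  let side : (ι ⊕ ι) ↪ Option (Bool × (ι ⊕ ι)) :=
    ⟨fun x => σ (some (true, x)), fun x y h => by simpa using h⟩
  have hside : (apexBipartite ι).IsClique (univ.map side : Finset _) := by
    rintro _ hx _ hy hxy
    obtain ⟨x, -, rfl⟩ := mem_map.1 (mem_coe.1 hx)
    obtain ⟨y, -, rfl⟩ := mem_map.1 (mem_coe.1 hy)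
    exact (antimorphism_adj σ fun h => hxy (congrArg σ h)).2 fun h => h.1 rfl
  have hcard := hside.card_le_of_coloring color
  simp at hcard
  lia

end Regular

section FiveCycle

variable {V : Type*} [Fintype V] {G : SimpleGraph V}

theorem five_lt_card_of_triangle (hG : G.IsRegularOfDegree 2) {u v w : V}
    (huv : G.Adj u v) (huw : G.Adj u w) (hvw : G.Adj v w) (hV : 3 < Fintype.card V) :
    5 < Fintype.card V := by
  have closed {x y z : V} (hy : G.Adj x y) (hz : G.Adj x z) (hyz : y ≠ z) (t : V) :
      G.Adj x t → t = y ∨ t = z := by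
    have hN : {y, z} = G.neighborFinset x := eq_of_subset_of_card_le
      (by simp [insert_subset_iff, hy, hz]) (by simp [hG x, card_pair hyz])
    simpa [← hN] using (G.mem_neighborFinset x t).2
  obtain ⟨d, -, hd⟩ := exists_mem_notMem_of_card_lt_card (s := {u, v, w}) (t := univ)
    (card_le_three.trans_lt (by simpa using hV))
  have hsub : G.neighborFinset d ⊆ ({d, u, v, w} : Finset V)ᶜ := by
    intro t ht
    have hdt := (G.mem_neighborFinset d t).1 ht
    simp only [mem_compl, mem_insert, mem_singleton, not_or] at hd ⊢
    refine ⟨hdt.ne', ?_, ?_, ?_⟩ <;> rintro rfl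
    · exact (closed huv huw hvw.ne d hdt.symm).elim hd.2.1 hd.2.2
    · exact (closed huv.symm hvw huw.ne d hdt.symm).elim hd.1 hd.2.2
    · exact (closed huw.symm hvw.symm huv.ne d hdt.symm).elim hd.1 hd.2.1
  have hle := card_le_card hsub
  rw [G.card_neighborFinset_eq_degree, hG, card_compl] at hle
  grind [huv.ne, huw.ne, hvw.ne]

theorem eq_of_le_of_sameDegrees {H : SimpleGraph V} (hle : H ≤ G) (hdeg : SameDegrees H G) :
    H = G := by
  ext v w
  have hN : H.neighborFinset v = G.neighborFinset v :=
    eq_of_subset_of_card_le (fun w hw => by simpa using hle (by simpa using hw))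
      (by simpa using (hdeg v).ge)
  simp only [← SimpleGraph.mem_neighborFinset, hN]

theorem eq_cycleGraph_five {H : SimpleGraph (Fin 5)} (hH : H.IsRegularOfDegree 2)
    (h01 : H.Adj 0 1) (h04 : H.Adj 0 4) (h12 : H.Adj 1 2) : H = SimpleGraph.cycleGraph 5 := by
  have hdeg (i : Fin 5) : (if H.Adj i 0 then 1 else 0) + (if H.Adj i 1 then 1 else 0) +
      (if H.Adj i 2 then 1 else 0) + (if H.Adj i 3 then 1 else 0) +
      (if H.Adj i 4 then 1 else 0) = 2 := by
    rw [← hH i, degree_eq_card_filter, card_filter, Fin.sum_univ_five]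
  have h02 : ¬ H.Adj 0 2 := by grind [hdeg 0]
  have h03 : ¬ H.Adj 0 3 := by grind [hdeg 0]
  have h13 : ¬ H.Adj 1 3 := by grind [hdeg 1, h01.symm]
  have h34 : H.Adj 3 4 := by grind [hdeg 3, H.irrefl (v := 3), SimpleGraph.adj_comm]
  have h32 : H.Adj 3 2 := by grind [hdeg 3, H.irrefl (v := 3), SimpleGraph.adj_comm]
  have hsucc (i : Fin 5) : H.Adj i (i + 1) := by
    fin_cases i
    exacts [h01, h12, h32.symm, h34, h04.symm]
  refine (eq_of_le_of_sameDegrees ?_ fun i => ?_).symm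
  · intro i j hij
    obtain h | h := SimpleGraph.cycleGraph_adj.1 hij
    · exact sub_eq_iff_eq_add'.1 h ▸ (hsucc j).symm
    · exact sub_eq_iff_eq_add'.1 h ▸ hsucc i
  · rw [hH i]
    convert SimpleGraph.cycleGraph_degree_three_le

theorem nonempty_iso_cycleGraph_five (hV : Fintype.card V = 5) (hG : G.IsRegularOfDegree 2) :
    Nonempty (G ≃g SimpleGraph.cycleGraph 5) := by
  obtain ⟨v⟩ : Nonempty V := Fintype.card_pos_iff.1 (by lia)
  obtain ⟨a, b, hab, hN⟩ := card_eq_two.1 ((G.card_neighborFinset_eq_degree v).trans (hG v))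
  have hva : G.Adj v a := by simp [← G.mem_neighborFinset, hN]
  have hvb : G.Adj v b := by simp [← G.mem_neighborFinset, hN]
  obtain ⟨c, hc, hcv⟩ := exists_mem_ne
    (((G.card_neighborFinset_eq_degree a).trans (hG a)).symm ▸ one_lt_two) v
  have hac : G.Adj a c := (G.mem_neighborFinset a c).1 hc
  have hcb : c ≠ b := by
    rintro rfl
    exact (five_lt_card_of_triangle hG hva hvb hac (by lia)).ne' hV
  obtain ⟨d, -, hd⟩ := exists_mem_notMem_of_card_lt_card (s := {v, a, c, b}) (t := univ)
    (card_le_four.trans_lt (by simp [hV]))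
  have hinj : Function.Injective ![v, a, c, d, b] := List.nodup_ofFn.1 (by
    simp only [mem_insert, mem_singleton, not_or] at hd
    simp [hva.ne, hvb.ne, hac.ne, hab, hcb, hd, hcv.symm, Ne.symm hd.1, Ne.symm hd.2.1,
      Ne.symm hd.2.2.1])
  let x : Fin 5 ≃ V :=
    .ofBijective _ ((Fintype.bijective_iff_injective_and_card _).2 ⟨hinj, by simp [hV]⟩)
  have hx : (G.comap x).IsRegularOfDegree 2 := fun i => by
    rw [← hG (x i)]
    exact ((SimpleGraph.Iso.comap x G).degree_eq i).symm
  exact ⟨(SimpleGraph.Iso.comap x G).symm.trans (by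
    rw [eq_cycleGraph_five hx hva hvb hac])⟩

theorem ForcesSC.isCore_of_isRegularOfDegree {k : ℕ} (h : ForcesSC G)
    (hG : G.IsRegularOfDegree k) : IsCore G := by
  obtain hV | ⟨⟨v⟩⟩ := isEmpty_or_nonempty V
  · exact .inl hV
  obtain ⟨σ⟩ := h.isSelfComplementary
  have hcard := degree_antimorphism σ v
  rw [hG, hG] at hcard
  obtain ⟨m, rfl⟩ : Even k := by
    by_contra hk
    have heven := G.even_card_odd_degree_vertices
    simp only [hG _, Nat.not_even_iff_odd.1 hk, filter_true, card_univ, ← hcard] at heven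
    grind
  rcases m with _ | _ | m
  · exact .inr (.inl (Fintype.card_eq_one_iff_nonempty_unique.1 hcard.symm))
  · exact .inr (.inr (nonempty_iso_cycleGraph_five hcard.symm hG))
  · have e : V ≃ Option (Bool × (Fin (m + 2) ⊕ Fin (m + 2))) :=
      Fintype.equivOfCardEq (by simp [← hcard]; lia)
    let f := SimpleGraph.Iso.comap e (apexBipartite (Fin (m + 2)))
    have hdeg : SameDegrees ((apexBipartite (Fin (m + 2))).comap e) G := fun v => by
      have hv := isRegularOfDegree_apexBipartite (e v)
      rw [Fintype.card_fin, two_mul] at hv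
      rw [hG v, ← hv]
      convert (f.degree_eq v).symm
      rfl
    exact (not_isSelfComplementary_apexBipartite (by rw [Fintype.card_fin]; lia)
      (.of_iso f.symm (h _ hdeg))).elim

end FiveCycle

/-! ### Peeling off a block -/

/-- The pair `(A, B)` can be peeled off `G`: every vertex of `A` is joined to all vertices outside
`B`, every vertex of `B` has its neighbours in `A`, and the edges between `A` and `B` join every
vertex to half of the other side, which has `2 * δ` elements. -/
structure IsPeelable {V : Type*} (G : SimpleGraph V) (A B : Finset V) (δ : ℕ) : Prop where
  disjoint : Disjoint A B
  adjOutside : ∀ v ∈ A, AdjOutside G B v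
  neighborsIn : ∀ y ∈ B, NeighborsIn G A y
  card_left : #A = 2 * δ
  card_right : #B = 2 * δ
  card_filter_left : ∀ v ∈ A, #{b ∈ B | G.Adj v b} = δ
  card_filter_right : ∀ y ∈ B, #{a ∈ A | G.Adj y a} = δ

theorem card_filter_equiv {ι V : Type*} [Fintype ι] {B : Finset V} (e : ι ≃ B) (p : V → Prop) :
    #{i | p (e i)} = #{b ∈ B | p b} := by
  simp only [card_filter]
  rw [Equiv.sum_comp e fun b => if p b then 1 else 0, sum_coe_sort B fun b => if p b then 1 else 0]

section IsPeelable

variable {V : Type*} {G : SimpleGraph V} {A B : Finset V} {δ : ℕ}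

theorem IsPeelable.adj_iff (h : IsPeelable G A B δ) {v w : V} (hv : v ∈ (A ∪ B : Set V))
    (hw : w ∉ (A ∪ B : Set V)) : G.Adj v w ↔ v ∈ (A : Set V) := by
  simp only [Set.mem_union, mem_coe, not_or] at hv hw ⊢
  constructor
  · exact fun hvw => hv.resolve_right fun hvB => hw.1 (h.neighborsIn v hvB w hvw)
  · exact fun hvA => h.adjOutside v hvA w hw.2 (by rintro rfl; exact hw.1 hvA)

theorem IsPeelable.isSplitPartition (h : IsPeelable G A B δ) :
    IsSplitPartition (G.induce (A ∪ B : Set V)) {v | ↑v ∈ (A : Set V)} := by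
  constructor
  · intro x hx y hy hxy
    exact h.adjOutside x hx y (disjoint_left.1 h.disjoint hy) fun e => hxy (Subtype.ext e.symm)
  · intro x hx y hy _ hxy
    exact hy (h.neighborsIn x (x.2.resolve_left hx) y hxy)

theorem IsPeelable.exists_iso_splitGraph (h : IsPeelable G A B δ) :
    ∃ r : Fin δ ⊕ Fin δ → Fin δ ⊕ Fin δ → Prop, IsBiregular r δ ∧
      Nonempty (G.induce (A ∪ B : Set V) ≃g splitGraph r) := by
  have a : Fin δ ⊕ Fin δ ≃ A := Fintype.equivOfCardEq (by simp [h.card_left, two_mul])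
  have b : Fin δ ⊕ Fin δ ≃ B := Fintype.equivOfCardEq (by simp [h.card_right, two_mul])
  refine ⟨fun i j => G.Adj (a i) (b j), ⟨fun i => ?_, fun j => ?_⟩, ⟨RelIso.symm
    { toEquiv := (a.sumCongr b).trans
        (Equiv.Set.union (Finset.disjoint_coe.2 h.disjoint)).symm
      map_rel_iff' := ?_ }⟩⟩
  · rw [card_filter_equiv b (G.Adj (a i)), h.card_filter_left _ (a i).2]
  · simp_rw [G.adj_comm _ (b j : V)]
    rw [card_filter_equiv a (G.Adj (b j)), h.card_filter_right _ (b j).2]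
  · rintro (i | i) (j | j)
    · change G.Adj (a i) (a j) ↔ i ≠ j
      refine ⟨fun hij e => G.irrefl (e ▸ hij), fun hij => h.adjOutside _ (a i).2 _
        (disjoint_left.1 h.disjoint (a j).2) fun e => hij (a.injective (Subtype.ext e.symm))⟩
    · exact Iff.rfl
    · exact G.adj_comm _ _
    · exact iff_of_false (fun hij => disjoint_left.1 h.disjoint
        (h.neighborsIn _ (b i).2 _ hij) (b j).2) id

end IsPeelable

section ForcesSwap

variable {V : Type*} [Fintype V] {G : SimpleGraph V} {A B : Finset V} {δ : ℕ}

theorem ForcesSwap.isPeelable (h : ForcesSwap G A B) (hAB : Disjoint A B)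
    (hA : ∀ a ∈ A, ∀ x ∉ A, G.degree x < G.degree a) (hdeg : ∀ b ∈ B, G.degree b = δ)
    (hB : B.Nonempty) : IsPeelable G A B δ := by
  obtain ⟨σ, hσ⟩ := h.exists_swaps
  have hcard := h.two_mul_degree_eq_card hAB hA hdeg hB
  have hneighbors (y : V) (hy : y ∈ B) := h.neighborsIn hAB hA hdeg hy
  have hfilter (y : V) (hy : y ∈ B) : #{a ∈ A | G.Adj y a} = δ := by
    rw [(hneighbors y hy).card_filter_adj, hdeg y hy]
  refine ⟨hAB, fun v hv => ?_, hneighbors, hcard.symm, hσ.card_eq.symm.trans hcard.symm,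
    fun v hv => ?_, hfilter⟩ <;>
  obtain ⟨y, rfl⟩ := σ.surjective v <;>
  have hy := (hσ.mem_left_iff y).1 hv
  · exact hσ.adjOutside_apply (hneighbors y hy)
  · have hnot := hσ.card_filter_not_adj (disjoint_right.1 hAB hy)
    have hsum := card_filter_add_card_filter_not (s := B) (G.Adj (σ y))
    rw [hnot, hfilter y hy, ← hσ.card_eq] at hsum
    lia

theorem ForcesSwap.exists_mem_union_iff (h : ForcesSwap G A B) {H : SimpleGraph V}
    (hH : SameDegrees H G) :
    ∃ σ : H ≃g Hᶜ, ∀ v, σ v ∈ (A ∪ B : Set V) ↔ v ∈ (A ∪ B : Set V) := by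
  obtain ⟨σ, hσ⟩ := h H hH
  refine ⟨σ, fun v => ?_⟩
  simp only [Set.mem_union, mem_coe, hσ.mem_left_iff, hσ.mem_right_iff, or_comm]

theorem ForcesSwap.forcesSC_induce_union (h : ForcesSwap G A B) :
    ForcesSC (G.induce (A ∪ B : Set V)) := by
  convert ForcesSC.induce_of_mem_iff fun _ hH => h.exists_mem_union_iff hH

theorem ForcesSwap.forcesSC_induce_compl (h : ForcesSwap G A B) :
    ForcesSC (G.induce (A ∪ B : Set V)ᶜ) := by
  convert ForcesSC.induce_of_mem_iff (T := (A ∪ B : Set V)ᶜ) fun _ hH =>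
    (h.exists_mem_union_iff hH).imp fun _ hσ v => (hσ v).not

theorem ForcesSwap.isBlock_induce_union {V : Type u} [Fintype V] {G : SimpleGraph V}
    {A B : Finset V} (h : ForcesSwap G A B) (hAB : IsPeelable G A B δ)
    (hA : A.Nonempty) : IsBlock (G.induce (A ∪ B : Set V)) := by
  obtain ⟨r, hr, ⟨e⟩⟩ := hAB.exists_iso_splitGraph
  have hδ : Nonempty (Fin δ) := Fin.pos_iff_nonempty.1 (by
    have := hA.card_pos
    rw [hAB.card_left] at this
    lia)
  exact ((h.forcesSC_induce_union.of_iso e).isBlock_splitGraph (by simpa using hr)).of_iso e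

end ForcesSwap

theorem ForcesSC.exists_isPeelable {V : Type*} [Fintype V] [Nonempty V] {G : SimpleGraph V}
    (h : ForcesSC G) (hG : ¬ ∃ k, G.IsRegularOfDegree k) :
    ∃ A B δ, A.Nonempty ∧ IsPeelable G A B δ ∧ ForcesSwap G A B := by
  have hA := maxDegreeFinset_nonempty (G := G)
  have hswap := h.forcesSwap
  obtain ⟨σ, hσ⟩ := hswap.exists_swaps
  have hB : (minDegreeFinset G).Nonempty := card_pos.1 (hσ.card_eq ▸ hA.card_pos)
  obtain ⟨y, hy⟩ := hB
  refine ⟨_, _, G.degree y, hA, hswap.isPeelable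
    (disjoint_maxDegreeFinset_minDegreeFinset hG) (fun a ha x hx => ?_) (fun b hb => ?_)
    ⟨y, hy⟩, hswap⟩
  · exact degree_lt_of_mem_maxDegreeFinset ha hx
  · exact le_antisymm (mem_minDegreeFinset.1 hb y) (mem_minDegreeFinset.1 hy b)

theorem ForcesSC.isElementarySCPseudoSplit {V : Type u} [Fintype V] {G : SimpleGraph V}
    (h : ForcesSC G) : IsElementarySCPseudoSplit G := by
  induction hn : Fintype.card V using Nat.strong_induction_on generalizing V with
  | _ n ih =>
    by_cases hG : ∃ k, G.IsRegularOfDegree k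
    · obtain ⟨k, hG⟩ := hG
      exact (h.isCore_of_isRegularOfDegree hG).isElementarySCPseudoSplit
    · have : Nonempty V := by
        by_contra hV
        exact hG ⟨0, fun v => (hV ⟨v⟩).elim⟩
      obtain ⟨A, B, δ, ⟨a, ha⟩, hAB, hswap⟩ := h.exists_isPeelable hG
      refine .of_iso (isoSplitComposition G _ A fun v hv w hw => hAB.adj_iff hv hw)
        ((hswap.isBlock_induce_union hAB ⟨a, ha⟩).splitComposition hAB.isSplitPartition
          (ih _ ?_ hswap.forcesSC_induce_compl rfl))
      rw [← hn]
      exact Fintype.card_subtype_lt (x := a) fun ha' => ha' (.inl ha)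

end ForciblySC

theorem theorem1 (d : List ℕ) (hd : ForciblySC.IsDegreeSequence.{u} d) :
    ForciblySC.IsForciblySelfComplementary.{u} d ↔
      ∀ (V : Type u) [Fintype V] (G : SimpleGraph V) [DecidableRel G.Adj],
        ForciblySC.degreeSequence G = d → ForciblySC.IsElementarySCPseudoSplit G :=
  ⟨fun h _ _ _ _ hG => (h.forcesSC hG).isElementarySCPseudoSplit,
    fun h V _ G _ hG => (h V G hG).isSelfComplementary⟩
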